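/- A permutation of length $n\ge 0$ is a bijection of $\{1,\dots,n\}$, written $\pi(1)\cdots\pi(n)$. A permutation $\sigma$ of length $k$ is contained in $\pi$ (of length $n$) if there are indices $1\le i_1<\cdots<i_k\le n$ such that $\pi(i_1)\cdots\pi(i_k)$ is order isomorphic to $\sigma$. A permutation class is a set of permutations closed downward under containment. A quasi-order is wqo if every infinite sequence $x_1,x_2,\dots$ of its elements has indices $i<j$ with $x_i\le x_j$; a set of permutations is wqo if it is wqo under containment. Given a quasi-order $(L,\le_L)$, an $L$-labeled permutation is a pair $(\pi,\ell_\pi)$ with $\ell_\pi:\{1,\dots,n\}\to L$, and $(\sigma,\ell_\sigma)$ is contained in $(\pi,\ell_\pi)$ if there are indices as above with, in addition, $\ell_\sigma(j)\le_L\ell_\pi(i_j)$ for all $1\le j\le k$. A set $\mathcal C$ of permutations is labeled well-quasi-ordered (lwqo) if, for every wqo $(L,\le_L)$, the set of all $L$-labeled members of $\mathcal C$ is wqo under this order. An interval of $\pi$ is a set $I$ of contiguous indices such that $\pi(I)$ is also contiguous; a permutation of length $n\ge 2$ is simple if its only intervals have lengths $0$, $1$ and $n$. For a $0/{\pm}1$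 matrix $M$, with entries $M(k,\ell)$ indexed by column $k$ (from left to right) and row $\ell$ (from bottom to top), let $\Lambda_M\subset\mathbb R^2$ be the union of the closed segments from $(k-1,\ell-1)$ to $(k,\ell)$ for $M(k,\ell)=1$ and from $(k-1,\ell)$ to $(k,\ell-1)$ for $M(k,\ell)=-1$. Let $\operatorname{Geom}(M)$ be the set of permutations in the same relative order as some finite subset of $\Lambda_M$ no two points of which lie on a common horizontal or vertical line. A set of permutations is geometrically griddable if it is contained in $\operatorname{Geom}(M)$ for some finite $0/{\pm}1$ matrix $M$. For a permutation $\sigma$ of length $m$ and nonempty permutations $\alpha_1,\dots,\alpha_m$, the inflation $\sigma[\alpha_1,\dots,\alpha_m]$ is obtained by replacing each entry $\sigma(i)$ by an interval order isomorphic to $\alpha_i$, the intervals themselves being in the relative order of $\sigma$. For classes $\mathcal C$ and $\mathcal U$, let $\mathcal C[\mathcal U]$ be the set of all inflations $\sigma[\alpha_1,\dots,\alpha_m]$ with $\sigma\in\mathcal C$ of length $m$ and nonempty $\alpha_1,\dots,\alpha_m\in\mathcal U$. **Theorem.** Let $\mathcal C$ be a permutation class such that the set of simple permutations in $\mathcal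 C$ is geometrically griddable. Then $\mathcal C$ is lwqo. Moreover, $\mathcal C[\mathcal U]$ is wqo for every wqo permutation class $\mathcal U$. -/

import Mathlib

universe u

/-- A finite permutation: a length `len` (possibly `0`) and a permutation of the `len` indices. -/
structure FinPerm where
  len : ℕ
  perm : Equiv.Perm (Fin len)

namespace FinPerm

/-- The containment order: `σ.Contained π` if some subsequence `π(i₁) ⋯ π(iₖ)` of `π` is
order isomorphic to `σ`. -/
def Contained (σ π : FinPerm) : Prop :=
  ∃ f : Fin σ.len ↪o Fin π.len,
    ∀ i j, σ.perm i < σ.perm j ↔ π.perm (f i) < π.perm (f j)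

/-- A permutation class: a set of permutations closed downward under containment. -/
def IsClass (C : Set FinPerm) : Prop :=
  ∀ π ∈ C, ∀ σ : FinPerm, σ.Contained π → σ ∈ C

/-- A set of permutations is wqo if it is so under containment. -/
def IsWQO (C : Set FinPerm) : Prop :=
  C.PartiallyWellOrderedOn Contained

/-- A set of contiguous indices whose set of values is also contiguous. -/
def IsInterval (π : FinPerm) (I : Set (Fin π.len)) : Prop :=
  I.OrdConnected ∧ (π.perm '' I).OrdConnected

/-- A permutation of length at least two is simple if all of its intervals have
length `0`, `1` or the full length. -/
def IsSimple (π : FinPerm) : Prop :=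
  2 ≤ π.len ∧ ∀ I : Set (Fin π.len), π.IsInterval I → I.ncard = 0 ∨ I.ncard = 1 ∨ I.ncard = π.len

/-- The inflation `σ[α₁, …, αₘ]`. The entry `j` of the `i`th block, which has position `(i, j)`
in the lexicographic order of the blocks from left to right, gets the value `αᵢ(j)` in the block
that is the `σ(i)`th from the bottom. -/
def inflate (σ : FinPerm) (α : Fin σ.len → FinPerm) : FinPerm where
  len := ∑ i, (α i).len
  perm :=
    (finSigmaFinEquiv (n := fun i => (α i).len)).symm
      |>.trans (Equiv.sigmaCongrRight fun i => (α i).perm)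
      |>.trans (Equiv.sigmaCongrLeft' (β := fun i => Fin (α i).len) σ.perm)
      |>.trans (finSigmaFinEquiv (n := fun k => (α (σ.perm.symm k)).len))
      |>.trans (finCongr (Equiv.sum_comp σ.perm.symm fun i => (α i).len))

/-- The inflation `C[U]`: all inflations of members of `C` by nonempty members of `U`. -/
def inflation (C U : Set FinPerm) : Set FinPerm :=
  {π | ∃ σ ∈ C, ∃ α : Fin σ.len → FinPerm,
    (∀ i, α i ∈ U ∧ 0 < (α i).len) ∧ π = σ.inflate α}

/-- A set of points in the plane is a drawing of `π` if, listing its points from left to right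
(with distinct first coordinates), their second coordinates are in the same relative order
as the entries of `π`. -/
def IsDrawing (S : Set (ℝ × ℝ)) (π : FinPerm) : Prop :=
  ∃ p : Fin π.len → ℝ × ℝ, Set.range p = S ∧
    (∀ i j, i < j ↔ (p i).1 < (p j).1) ∧
    (∀ i j, π.perm i < π.perm j ↔ (p i).2 < (p j).2)

/-- The standard figure of a `0/±1` matrix. Columns `k` are numbered from left to right and rows
`l` from bottom to top (column index first); indices start at `0`. -/
def standardFigure {t s : ℕ} (M : Matrix (Fin t) (Fin s) SignType) : Set (ℝ × ℝ) :=
  {z | ∃ (k : Fin t) (l : Fin s),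
    (M k l = 1 ∧ z ∈ segment ℝ ((k : ℝ), (l : ℝ)) ((k : ℝ) + 1, (l : ℝ) + 1)) ∨
    (M k l = -1 ∧ z ∈ segment ℝ ((k : ℝ), (l : ℝ) + 1) ((k : ℝ) + 1, (l : ℝ)))}

/-- The geometric grid class of `M`: the permutations that can be drawn on its standard figure. -/
def Geom {t s : ℕ} (M : Matrix (Fin t) (Fin s) SignType) : Set FinPerm :=
  {π | ∃ S : Set (ℝ × ℝ), S ⊆ standardFigure M ∧ IsDrawing S π}

/-- A set of permutations is geometrically griddable if a single geometric grid class contains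
all of it. -/
def GeometricallyGriddable (X : Set FinPerm) : Prop :=
  ∃ (t s : ℕ) (M : Matrix (Fin t) (Fin s) SignType), X ⊆ Geom M

end FinPerm

/-- A permutation with a label from `L` on each index. -/
structure LabeledPerm (L : Type u) extends FinPerm where
  label : Fin len → L

namespace LabeledPerm

/-- Containment of labeled permutations: a containment that maps each entry to an entry with a
label at least as large. -/
def Contained {L : Type u} [Preorder L] (σ π : LabeledPerm L) : Prop :=
  ∃ f : Fin σ.len ↪o Fin π.len,
    (∀ i j, σ.perm i < σ.perm j ↔ π.perm (f i) < π.perm (f j)) ∧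
    ∀ i, σ.label i ≤ π.label (f i)

end LabeledPerm

namespace FinPerm

/-- The set `C ≀ L` of `L`-labeled members of `C`. -/
def labeled (C : Set FinPerm) (L : Type u) : Set (LabeledPerm L) :=
  {π | π.toFinPerm ∈ C}

/-- `C` is labeled well-quasi-ordered: `C ≀ L` is wqo for every wqo `L`. -/
def IsLWQO (C : Set FinPerm) : Prop :=
  ∀ (L : Type u) [Preorder L], WellQuasiOrderedLE L →
    (labeled C L).PartiallyWellOrderedOn LabeledPerm.Contained

end FinPerm

/-!
A geometric grid class is encoded by words over a finite alphabet: on the diagonals of the cells,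
a point is equally far from the vertical and the horizontal midline of its cell, so if the points
are listed by increasing distance from these midlines, the order of two of them, in either
coordinate, is determined by the half cells in which they lie. Hence such classes are lwqo by
Higman's lemma.

Contracting proper intervals shows that every permutation of length at least two is an inflation of
a simple one, that is, a simple permutation labeled by its blocks. The blocks of the members of a
minimal bad sequence are wqo (Nash-Williams), so these labeled simple permutations are wqo too,
contradicting badness. The same encoding presents the members of `C[U]` as members of `C` labeled by
members of `U`.
-/

open Set

theorem exists_orderEmbedding_of_wellQuasiOrdered {A : Type*} {r : A → A → Prop} [IsPreorder A r]
    (hr : WellQuasiOrdered r) (len : ℕ → ℕ) (word : ∀ n, Fin (len n) → A) :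
    ∃ m n, m < n ∧ ∃ f : Fin (len m) ↪o Fin (len n), ∀ i, r (word m i) (word n (f i)) := by
  obtain ⟨m, n, hmn, hsub⟩ := (PartiallyWellOrderedOn.partiallyWellOrderedOn_sublistForall₂ r
    (partiallyWellOrderedOn_univ_iff.2 hr)).exists_lt (f := fun n => List.ofFn (word n))
    fun _ _ _ => mem_univ _
  obtain ⟨l, hl, hsublist⟩ := List.sublistForall₂_iff.1 hsub
  obtain ⟨f, hf⟩ := List.sublist_iff_exists_fin_orderEmbedding_get_eq.1 hsublist
  have hlen : len m = l.length := by simpa using hl.length_eq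
  refine ⟨m, n, hmn, ((Fin.castOrderIso hlen).toOrderEmbedding.trans f).trans
    (Fin.castOrderIso List.length_ofFn).toOrderEmbedding, fun i => ?_⟩
  have hri := hl.get (i := i) (by simp) (by simp [← hlen])
  have hfi := hf (Fin.cast hlen i)
  simp only [List.get_eq_getElem, List.getElem_ofFn, Fin.val_cast] at hri hfi
  rw [hfi] at hri
  simpa using! hri

/-- Nash-Williams' argument: a bad sequence below `f` could replace a tail of `f`. -/
theorem partiallyWellOrderedOn_of_isMinBadSeq {α : Type*} {r : α → α → Prop} [IsTrans α r]
    {rk : α → ℕ} {s : Set α} {f : ℕ → α} (hf : PartiallyWellOrderedOn.IsBadSeq r s f)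
    (hmin : ∀ n, PartiallyWellOrderedOn.IsMinBadSeq r rk s n f) :
    {a ∈ s | ∃ n, r a (f n) ∧ rk a < rk (f n)}.PartiallyWellOrderedOn r := by
  rw [partiallyWellOrderedOn_iff_exists_lt]
  intro g hg
  choose hgs idx hle hrk using hg
  by_contra! hbad
  let k := Function.argmin idx
  have hk : ∀ i, idx k ≤ idx i := fun i => Function.argmin_le idx i
  refine hmin (idx k) (fun m => if m < idx k then f m else g (k + (m - idx k)))
    (fun m hm => by simp [hm]) (by simpa using hrk k) ⟨fun n => ?_, fun m n hmn => ?_⟩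
  · dsimp only
    split_ifs
    exacts [hf.1 n, hgs _]
  · dsimp only
    split_ifs with hm hn hn
    · exact hf.2 m n hmn
    · exact fun h => hf.2 m _ (hm.trans_le (hk _)) (_root_.trans h (hle _))
    · omega
    · exact hbad _ _ (by omega)

theorem lt_iff_lt_of_ordConnected {α : Type*} [LinearOrder α] {s : Set α}
    (hs : s.OrdConnected) {a b c : α} (ha : a ∈ s) (hc : c ∈ s) (hb : b ∉ s) : a < b ↔ c < b := by
  have key : ∀ a ∈ s, ∀ c ∈ s, a < b → c < b := by
    intro a ha c hc hab
    by_contra! hbc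
    exact hb (hs.out ha hc ⟨hab.le, hbc⟩)
  exact ⟨key a ha c hc, key c hc a ha⟩

theorem finSigmaFinEquiv_lt_of_fst_lt {m : ℕ} {n : Fin m → ℕ} {i j : Fin m} (hij : i < j)
    (a : Fin (n i)) (b : Fin (n j)) : finSigmaFinEquiv ⟨i, a⟩ < finSigmaFinEquiv ⟨j, b⟩ := by
  have sum_Iio (i : Fin m) : ∑ k : Fin i, n (Fin.castLE i.2.le k) = ∑ k < i, n k := by
    have h : Finset.univ.map (Fin.castLEEmb i.2.le) = Finset.Iio i := by
      ext k
      simp only [Finset.mem_map, Finset.mem_univ, true_and, Finset.mem_Iio]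
      exact ⟨fun ⟨l, hl⟩ => hl ▸ l.2, fun hk => ⟨⟨k, hk⟩, rfl⟩⟩
    rw [← h, Finset.sum_map]
    rfl
  rw [Fin.lt_def, finSigmaFinEquiv_apply, finSigmaFinEquiv_apply, sum_Iio, sum_Iio]
  calc ∑ k < i, n k + a < ∑ k ≤ i, n k := by
        rw [← Finset.sum_Iio_add_eq_sum_Iic]
        gcongr
        exact a.2
    _ ≤ ∑ k < j, n k := by
        refine Finset.sum_le_sum_of_subset fun k hk => ?_
        exact Finset.mem_Iio.2 ((Finset.mem_Iic.1 hk).trans_lt hij)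
    _ ≤ _ := Nat.le_add_right _ _

theorem finSigmaFinEquiv_lt_iff_of_fst_ne {m : ℕ} {n : Fin m → ℕ} {i j : Fin m} (hij : i ≠ j)
    (a : Fin (n i)) (b : Fin (n j)) :
    finSigmaFinEquiv ⟨i, a⟩ < finSigmaFinEquiv ⟨j, b⟩ ↔ i < j := by
  obtain h | h := hij.lt_or_gt
  · exact iff_of_true (finSigmaFinEquiv_lt_of_fst_lt h a b) h
  · exact iff_of_false (finSigmaFinEquiv_lt_of_fst_lt h b a).not_gt h.not_gt

theorem finSigmaFinEquiv_mk_lt_mk {m : ℕ} {n : Fin m → ℕ} {i : Fin m} {a b : Fin (n i)} :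
    finSigmaFinEquiv ⟨i, a⟩ < finSigmaFinEquiv ⟨i, b⟩ ↔ a < b := by
  rw [Fin.lt_def, finSigmaFinEquiv_apply, finSigmaFinEquiv_apply, Nat.add_lt_add_iff_left,
    ← Fin.lt_def]

namespace FinPerm

/-- The entries of `σ` at `i` and `j` are in the same relative order, both by position and by value,
as the entries of `π` at `k` and `l`. -/
def SameOrder (σ π : FinPerm) (i j : Fin σ.len) (k l : Fin π.len) : Prop :=
  (i < j ↔ k < l) ∧ (σ.perm i < σ.perm j ↔ π.perm k < π.perm l)

namespace SameOrder

variable {σ τ π : FinPerm} {i j : Fin σ.len} {k l : Fin τ.len} {p q : Fin π.len}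

theorem refl (σ : FinPerm) (i j : Fin σ.len) : σ.SameOrder σ i j i j :=
  ⟨Iff.rfl, Iff.rfl⟩

theorem diag (σ τ : FinPerm) (i : Fin σ.len) (k : Fin τ.len) : σ.SameOrder τ i i k k :=
  ⟨iff_of_false (lt_irrefl _) (lt_irrefl _), iff_of_false (lt_irrefl _) (lt_irrefl _)⟩

theorem symm (h : σ.SameOrder τ i j k l) : τ.SameOrder σ k l i j :=
  ⟨h.1.symm, h.2.symm⟩

theorem trans (h : σ.SameOrder τ i j k l) (h' : τ.SameOrder π k l p q) : σ.SameOrder π i j p q :=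
  ⟨h.1.trans h'.1, h.2.trans h'.2⟩

theorem swap (h : σ.SameOrder τ i j k l) (hij : i ≠ j) (hkl : k ≠ l) : σ.SameOrder τ j i l k := by
  constructor
  · rw [← not_le, ← not_le, hij.le_iff_lt, hkl.le_iff_lt, h.1]
  · rw [← not_le, ← not_le, (σ.perm.injective.ne hij).le_iff_lt,
      (τ.perm.injective.ne hkl).le_iff_lt, h.2]

end SameOrder

theorem sameOrder_of_forall_lt {σ π : FinPerm} {ι : Type*} [LinearOrder ι] {x : ι → Fin σ.len}
    {y : ι → Fin π.len} (hx : x.Injective) (hy : y.Injective)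
    (h : ∀ s t, s < t → σ.SameOrder π (x s) (x t) (y s) (y t)) (s t : ι) :
    σ.SameOrder π (x s) (x t) (y s) (y t) := by
  rcases lt_trichotomy s t with hst | rfl | hst
  · exact h s t hst
  · exact .diag _ _ _ _
  · exact (h t s hst).swap (hx.ne hst.ne) (hy.ne hst.ne)

theorem contained_of_sameOrder {σ π : FinPerm} (f : Fin σ.len → Fin π.len)
    (hf : ∀ i j, σ.SameOrder π i j (f i) (f j)) : σ.Contained π :=
  ⟨OrderEmbedding.ofStrictMono f fun i j => (hf i j).1.1, fun i j => (hf i j).2⟩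

theorem IsLWQO.mono {C D : Set FinPerm} (hD : IsLWQO.{u} D) (h : C ⊆ D) : IsLWQO.{u} C :=
  fun L _ hL => (hD L hL).mono fun _ hπ => h hπ

end FinPerm

namespace LabeledPerm

variable {L : Type u} [Preorder L]

theorem contained_iff_exists_sameOrder {σ π : LabeledPerm L} :
    σ.Contained π ↔ ∃ f : Fin σ.len → Fin π.len,
      (∀ i j, σ.SameOrder π.toFinPerm i j (f i) (f j)) ∧ ∀ i, σ.label i ≤ π.label (f i) :=
  ⟨fun ⟨f, hf, hl⟩ => ⟨f, fun i j => ⟨f.lt_iff_lt.symm, hf i j⟩, hl⟩,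
    fun ⟨f, hf, hl⟩ => ⟨OrderEmbedding.ofStrictMono f fun i j => (hf i j).1.1,
      fun i j => (hf i j).2, hl⟩⟩

instance instPreorder : Preorder (LabeledPerm L) where
  le := Contained
  le_refl _ := ⟨RelEmbedding.refl _, fun _ _ => Iff.rfl, fun _ => le_rfl⟩
  le_trans := by
    rintro σ τ π ⟨f, hf, hfl⟩ ⟨g, hg, hgl⟩
    exact ⟨f.trans g, fun i j => (hf i j).trans (hg _ _), fun i => (hfl i).trans (hgl _)⟩

instance : IsTrans (LabeledPerm L) Contained :=
  ⟨fun _ _ _ => le_trans (α := LabeledPerm L)⟩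

end LabeledPerm

namespace FinPerm

/-- The permutations encoded by words over the alphabet `A`: their entries can be listed in such a
way that the relative order of two of them, by position and by value, is read off from the letters
of the earlier and the later one through `R` and `S`. -/
def codedClass {A : Type*} (R S : A → A → Prop) : Set FinPerm :=
  {π | ∃ (e : Equiv.Perm (Fin π.len)) (word : Fin π.len → A), ∀ s t, s < t →
    (e s < e t ↔ R (word s) (word t)) ∧
      (π.perm (e s) < π.perm (e t) ↔ S (word s) (word t))}

theorem isLWQO_codedClass {A : Type*} [Finite A] (R S : A → A → Prop) :
    IsLWQO.{u} (codedClass R S) := by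
  intro L _ hL
  rw [partiallyWellOrderedOn_iff_exists_lt]
  intro π hπ
  choose e word hword using hπ
  let r : A × L → A × L → Prop := fun x y => x.1 = y.1 ∧ x.2 ≤ y.2
  have : IsPreorder (A × L) r :=
    { refl _ := ⟨rfl, le_rfl⟩
      trans _ _ _ h h' := ⟨h.1.trans h'.1, h.2.trans h'.2⟩ }
  have hr : WellQuasiOrdered r := (Finite.wellQuasiOrdered (· = ·)).prod hL.wqo
  obtain ⟨m, n, hmn, f, hf⟩ := exists_orderEmbedding_of_wellQuasiOrdered hr (fun n => (π n).len)
    fun n i => (word n i, (π n).label (e n i))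
  have word_eq (i) : word m i = word n (f i) := (hf i).1
  have sameOrder : ∀ s t,
      (π m).SameOrder (π n).toFinPerm (e m s) (e m t) (e n (f s)) (e n (f t)) := by
    refine sameOrder_of_forall_lt (e m).injective ((e n).injective.comp f.injective)
      fun s t hst => ?_
    have hm := hword m s t hst
    have hn := hword n (f s) (f t) (f.lt_iff_lt.2 hst)
    rw [← word_eq, ← word_eq] at hn
    exact ⟨hm.1.trans hn.1.symm, hm.2.trans hn.2.symm⟩
  refine ⟨m, n, hmn, LabeledPerm.contained_iff_exists_sameOrder.2
    ⟨fun i => e n (f ((e m).symm i)), fun i j => ?_, fun i => ?_⟩⟩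
  · simpa using! sameOrder ((e m).symm i) ((e m).symm j)
  · simpa using! (hf ((e m).symm i)).2

theorem isLWQO_setOf_len_le_one : IsLWQO.{u} {π | π.len ≤ 1} :=
  (isLWQO_codedClass (A := Unit) (fun _ _ => True) fun _ _ => True).mono
    fun π (hπ : π.len ≤ 1) => ⟨1, fun _ => (), fun s t hst => by omega⟩

/-- The half of the `k`th column (or row) in which the coordinate `x` lies: the second component
says whether `x` is beyond the midline. -/
def halfCell {t : ℕ} (k : Fin t) (x : ℝ) : Fin t × Prop :=
  (k, (k : ℝ) + 1 / 2 < x)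

/-- The order of two distinct coordinates in the half cells `a` and `b`, provided that the second
one is at least as far from its midline as the first one: within a single column it is
the outer point that decides. -/
def HalfCellLT {t : ℕ} (a b : Fin t × Prop) : Prop :=
  a.1 < b.1 ∨ a.1 = b.1 ∧ b.2

theorem lt_iff_halfCellLT {t : ℕ} {k l : Fin t} {x y : ℝ} (hne : x ≠ y)
    (hxy : |x - (k + 1 / 2)| ≤ |y - (l + 1 / 2)|) (hy : |y - (l + 1 / 2)| ≤ 1 / 2) :
    x < y ↔ HalfCellLT (halfCell k x) (halfCell l y) := by
  have hx := abs_le.1 (hxy.trans hy)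
  have hy' := abs_le.1 hy
  simp only [HalfCellLT, halfCell]
  rcases lt_trichotomy k l with hkl | rfl | hkl
  · have : (k : ℝ) + 1 ≤ l := by exact_mod_cast hkl
    simp only [hkl, true_or, iff_true]
    exact lt_of_le_of_ne (by linarith) hne
  · simp only [lt_irrefl, true_and, false_or]
    refine ⟨fun h => ?_, fun h => ?_⟩
    · by_contra! hle
      rw [abs_of_nonpos (a := y - _) (by linarith)] at hxy
      linarith [(abs_le.1 hxy).1]
    · rw [abs_of_pos (a := y - _) (by linarith)] at hxy
      exact lt_of_le_of_ne (by linarith [(abs_le.1 hxy).2]) hne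
  · have : (l : ℝ) + 1 ≤ k := by exact_mod_cast hkl
    simp only [hkl.not_gt, hkl.ne', false_and, or_false, iff_false, not_lt]
    linarith

theorem exists_abs_sub_eq_of_mem_standardFigure {t s : ℕ} {M : Matrix (Fin t) (Fin s) SignType}
    {z : ℝ × ℝ} (hz : z ∈ standardFigure M) :
    ∃ (k : Fin t) (l : Fin s), |z.1 - (k + 1 / 2)| = |z.2 - (l + 1 / 2)| ∧
      |z.1 - (k + 1 / 2)| ≤ 1 / 2 := by
  obtain ⟨k, l, h⟩ := hz
  simp only [segment_eq_image, mem_image] at h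
  refine ⟨k, l, ?_⟩
  rcases h with ⟨-, c, ⟨h0, h1⟩, rfl⟩ | ⟨-, c, ⟨h0, h1⟩, rfl⟩ <;>
    simp only [Prod.fst_add, Prod.snd_add, Prod.smul_fst, Prod.smul_snd, smul_eq_mul] <;>
    refine ⟨?_, abs_le.2 ⟨by linarith, by linarith⟩⟩
  · ring_nf
  · rw [← abs_neg]
    ring_nf

/-- List the points of the drawing by increasing distance from the midlines of their cells. -/
theorem geom_subset_codedClass {t s : ℕ} (M : Matrix (Fin t) (Fin s) SignType) :
    Geom M ⊆ codedClass
      (fun a b : (Fin t × Prop) × (Fin s × Prop) => HalfCellLT a.1 b.1)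
      (fun a b => HalfCellLT a.2 b.2) := by
  rintro π ⟨S, hS, p, rfl, hx, hy⟩
  choose k l heq hle using fun i => exists_abs_sub_eq_of_mem_standardFigure (hS (mem_range_self i))
  let d : Fin π.len → ℝ := fun i => |(p i).1 - (k i + 1 / 2)|
  refine ⟨Tuple.sort d, (fun i => (halfCell (k i) (p i).1, halfCell (l i) (p i).2)) ∘ Tuple.sort d,
    fun i j hij => ?_⟩
  have hd : d (Tuple.sort d i) ≤ d (Tuple.sort d j) := Tuple.monotone_sort d hij.le
  have hne : Tuple.sort d i ≠ Tuple.sort d j := (Tuple.sort d).injective.ne hij.ne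
  have hx_inj : Function.Injective fun i => (p i).1 :=
    StrictMono.injective fun i j => (hx i j).1
  have hy_inj : Function.Injective fun i => (p i).2 := by
    have : StrictMono fun v => (p (π.perm.symm v)).2 := fun v w h => (hy _ _).1 (by simpa using h)
    simpa [Function.comp_def] using this.injective.comp π.perm.injective
  rw [hx, hy]
  refine ⟨lt_iff_halfCellLT (hx_inj.ne hne) hd (hle _), lt_iff_halfCellLT (hy_inj.ne hne) ?_ ?_⟩
  · rwa [← heq, ← heq]
  · rw [← heq]
    exact hle _

theorem GeometricallyGriddable.isLWQO {X : Set FinPerm} (hX : GeometricallyGriddable X) :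
    IsLWQO.{u} X := by
  obtain ⟨t, s, M, h⟩ := hX
  exact (isLWQO_codedClass _ _).mono (h.trans (geom_subset_codedClass M))

end FinPerm

namespace LabeledPerm

variable {L : Type u}

/-- `π` is the inflation of `σ` by its labels: `entry i a` is the index in `π` of the `a`th entry
of the `i`th block, which is a copy of `σ.label i`. Blocks are allowed to be empty. -/
structure IsInflation (π : LabeledPerm L) (σ : LabeledPerm (LabeledPerm L))
    (entry : ∀ i, Fin (σ.label i).len → Fin π.len) : Prop where
  exists_eq : ∀ p, ∃ i a, entry i a = p
  sameOrder_of_ne : ∀ {i j} a b, i ≠ j → π.SameOrder σ.toFinPerm (entry i a) (entry j b) i j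
  sameOrder : ∀ i a b, π.SameOrder (σ.label i).toFinPerm (entry i a) (entry i b) a b
  label_eq : ∀ i a, π.label (entry i a) = (σ.label i).label a

theorem IsInflation.le [Preorder L] {π ρ : LabeledPerm L} {σ τ : LabeledPerm (LabeledPerm L)}
    {entry : ∀ i, Fin (σ.label i).len → Fin π.len} {entry' : ∀ i, Fin (τ.label i).len → Fin ρ.len}
    (hπ : π.IsInflation σ entry) (hρ : ρ.IsInflation τ entry') (h : σ ≤ τ) : π ≤ ρ := by
  obtain ⟨f, hf, hblock⟩ := contained_iff_exists_sameOrder.1 h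
  have hf_inj : f.Injective := StrictMono.injective fun i j => (hf i j).1.1
  choose g hg hlabel using fun i => contained_iff_exists_sameOrder.1 (hblock i)
  have key : ∀ i a j b, π.SameOrder ρ.toFinPerm (entry i a) (entry j b)
      (entry' (f i) (g i a)) (entry' (f j) (g j b)) := by
    intro i a j b
    obtain rfl | hij := eq_or_ne i j
    · exact (hπ.sameOrder i a b).trans ((hg i a b).trans (hρ.sameOrder _ _ _).symm)
    · exact (hπ.sameOrder_of_ne a b hij).trans
        ((hf i j).trans (hρ.sameOrder_of_ne _ _ (hf_inj.ne hij)).symm)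
  choose block index h_entry using hπ.exists_eq
  refine contained_iff_exists_sameOrder.2
    ⟨fun p => entry' (f (block p)) (g _ (index p)), fun p q => ?_, fun p => ?_⟩
  · simpa only [h_entry] using key (block p) (index p) (block q) (index q)
  · have h := hlabel (block p) (index p)
    rwa [← hπ.label_eq, ← hρ.label_eq, h_entry] at h

/-- The labeled counterpart of `FinPerm.inflation`: all inflations of members of `C` by labeled
permutations from `R`. -/
def inflation (C : Set FinPerm) (R : Set (LabeledPerm L)) : Set (LabeledPerm L) :=
  {π | ∃ σ : LabeledPerm (LabeledPerm L), σ.toFinPerm ∈ C ∧ (∀ i, σ.label i ∈ R) ∧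
    ∃ entry, π.IsInflation σ entry}

end LabeledPerm

namespace FinPerm

theorem IsLWQO.partiallyWellOrderedOn_inflation {L : Type u} [Preorder L] {C : Set FinPerm}
    (hC : IsLWQO.{u} C) {R : Set (LabeledPerm L)}
    (hR : R.PartiallyWellOrderedOn LabeledPerm.Contained) :
    (LabeledPerm.inflation C R).PartiallyWellOrderedOn LabeledPerm.Contained := by
  rw [partiallyWellOrderedOn_iff_exists_lt]
  intro π hπ
  choose σ hσ hlabel entry hentry using hπ
  have hR' : WellQuasiOrderedLE R := ⟨hR⟩
  obtain ⟨m, n, hmn, f, hf, hl⟩ := (hC R hR').exists_lt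
    (f := fun n => ⟨(σ n).toFinPerm, fun i => ⟨(σ n).label i, hlabel n i⟩⟩) hσ
  exact ⟨m, n, hmn, (hentry m).le (hentry n) ⟨f, hf, hl⟩⟩

/-- The pattern of `π` on the set `P` of indices. -/
noncomputable def pattern (π : FinPerm) (P : Finset (Fin π.len)) : FinPerm where
  len := P.card
  perm := (Tuple.sort fun i => π.perm (P.orderEmbOfFin rfl i))⁻¹

theorem sameOrder_pattern (π : FinPerm) (P : Finset (Fin π.len)) (i j : Fin P.card) :
    (π.pattern P).SameOrder π i j (P.orderEmbOfFin rfl i) (P.orderEmbOfFin rfl j) := by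
  refine ⟨(P.orderEmbOfFin rfl).lt_iff_lt.symm, ?_⟩
  let value : Fin P.card → Fin π.len := fun i => π.perm (P.orderEmbOfFin rfl i)
  have hsorted : StrictMono (value ∘ Tuple.sort value) :=
    (Tuple.monotone_sort value).strictMono_of_injective
      ((π.perm.injective.comp (P.orderEmbOfFin rfl).injective).comp (Tuple.sort value).injective)
  change (Tuple.sort value)⁻¹ i < (Tuple.sort value)⁻¹ j ↔ value i < value j
  simpa using! hsorted.lt_iff_lt (a := (Tuple.sort value)⁻¹ i) (b := (Tuple.sort value)⁻¹ j) |>.symm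

/-- `b` sends the entries of `π` to those of `σ` and keeps the relative order of any two entries
that it does not identify. In other words, `π` is an inflation of `σ` whose `k`th block is the fiber
of `b` over `k`. -/
structure IsContraction (π σ : FinPerm) (b : Fin π.len → Fin σ.len) : Prop where
  surjective : b.Surjective
  sameOrder : ∀ i j, b i ≠ b j → π.SameOrder σ i j (b i) (b j)

namespace IsContraction

variable {π σ τ : FinPerm} {b : Fin π.len → Fin σ.len} {b' : Fin σ.len → Fin τ.len}

theorem id (π : FinPerm) : π.IsContraction π id :=
  ⟨Function.surjective_id, fun i j _ => .refl π i j⟩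

theorem comp (hb' : σ.IsContraction τ b') (hb : π.IsContraction σ b) :
    π.IsContraction τ (b' ∘ b) :=
  ⟨hb'.surjective.comp hb.surjective, fun i j hij =>
    (hb.sameOrder i j (ne_of_apply_ne b' hij)).trans (hb'.sameOrder _ _ hij)⟩

theorem contained (hb : π.IsContraction σ b) : σ.Contained π := by
  choose s hs using hb.surjective
  refine contained_of_sameOrder s fun i j => ?_
  obtain rfl | hij := eq_or_ne i j
  · exact .diag _ _ _ _
  · simpa only [hs] using (hb.sameOrder (s i) (s j) (by rwa [hs, hs])).symm

end IsContraction

theorem exists_isContraction_pattern_image {π : FinPerm} {r : Fin π.len → Fin π.len}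
    (hr : ∀ i j, r i ≠ r j → π.SameOrder π i j (r i) (r j)) :
    ∃ b, π.IsContraction (π.pattern (Finset.univ.image r)) b := by
  set P := Finset.univ.image r
  have hrP (i) : r i ∈ P := Finset.mem_image_of_mem r (Finset.mem_univ i)
  let b : Fin π.len → Fin P.card := fun i => (P.orderIsoOfFin rfl).symm ⟨r i, hrP i⟩
  have hb (i) : P.orderEmbOfFin rfl (b i) = r i := by
    rw [← Finset.coe_orderIsoOfFin_apply, OrderIso.apply_symm_apply]
  refine ⟨b, fun k => ?_, fun i j hij => ?_⟩
  · obtain ⟨i, -, hi⟩ := Finset.mem_image.1 (Finset.orderEmbOfFin_mem P rfl k)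
    exact ⟨i, (P.orderEmbOfFin rfl).injective ((hb i).trans hi)⟩
  · have hne : r i ≠ r j := by
      rw [← hb, ← hb]
      exact (P.orderEmbOfFin rfl).injective.ne hij
    have h := (sameOrder_pattern π P (b i) (b j)).symm
    rw [hb, hb] at h
    exact (hr i j hne).trans h

theorem IsInterval.sameOrder {π : FinPerm} {I : Set (Fin π.len)} (hI : π.IsInterval I)
    {a b c : Fin π.len} (ha : a ∈ I) (hc : c ∈ I) (hb : b ∉ I) : π.SameOrder π a b c b :=
  ⟨lt_iff_lt_of_ordConnected hI.1 ha hc hb,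
    lt_iff_lt_of_ordConnected hI.2 (mem_image_of_mem _ ha) (mem_image_of_mem _ hc)
      (by rwa [π.perm.injective.mem_set_image])⟩

theorem IsInterval.exists_isContraction {π : FinPerm} {I : Set (Fin π.len)} (hI : π.IsInterval I)
    (hnontrivial : I.Nontrivial) (hproper : I ≠ univ) :
    ∃ σ b, π.IsContraction σ b ∧ 2 ≤ σ.len ∧ σ.len < π.len := by
  classical
  obtain ⟨c, hc, d, hd, hcd⟩ := hnontrivial
  obtain ⟨x, hx⟩ := (ne_univ_iff_exists_notMem I).1 hproper
  let r : Fin π.len → Fin π.len := fun i => if i ∈ I then c else i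
  have hr : ∀ i j, r i ≠ r j → π.SameOrder π i j (r i) (r j) := by
    intro i j hij
    simp only [r] at hij ⊢
    split_ifs at hij ⊢ with hi hj hj
    · exact absurd rfl hij
    · exact hI.sameOrder hi hc hj
    · exact (hI.sameOrder hj hc hi).swap (by rintro rfl; exact hi hj) hij.symm
    · exact .refl π i j
  obtain ⟨b, hb⟩ := exists_isContraction_pattern_image hr
  have hrc : c ∈ Finset.univ.image r := Finset.mem_image.2 ⟨c, Finset.mem_univ c, if_pos hc⟩
  have hrx : x ∈ Finset.univ.image r := Finset.mem_image.2 ⟨x, Finset.mem_univ x, if_neg hx⟩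
  have hrd : d ∉ Finset.univ.image r := by
    simp only [Finset.mem_image, Finset.mem_univ, true_and, not_exists, r]
    intro i hi
    split_ifs at hi with hiI
    exacts [hcd hi, hiI (hi ▸ hd)]
  refine ⟨_, b, hb, Finset.one_lt_card.2 ⟨c, hrc, x, hrx, ?_⟩, ?_⟩
  · rintro rfl
    exact hx hc
  · simpa [pattern] using Finset.card_lt_univ_of_notMem hrd

theorem exists_isInterval_of_not_isSimple {π : FinPerm} (hπ : 2 ≤ π.len) (h : ¬ π.IsSimple) :
    ∃ I, π.IsInterval I ∧ I.Nontrivial ∧ I ≠ univ := by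
  rw [IsSimple, not_and] at h
  push Not at h
  obtain ⟨I, hI, h0, h1, hlen⟩ := h hπ
  refine ⟨I, hI, ?_, ?_⟩
  · rw [← one_lt_ncard_iff_nontrivial]
    omega
  · rintro rfl
    simp [ncard_univ] at hlen

theorem exists_isSimple_isContraction (π : FinPerm) (hπ : 2 ≤ π.len) :
    ∃ σ b, σ.IsSimple ∧ π.IsContraction σ b := by
  by_cases hsimple : π.IsSimple
  · exact ⟨π, id, hsimple, .id π⟩
  · obtain ⟨I, hI, hnontrivial, hproper⟩ := exists_isInterval_of_not_isSimple hπ hsimple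
    obtain ⟨τ, b, hb, hτ, _⟩ := hI.exists_isContraction hnontrivial hproper
    obtain ⟨σ, b', hσ, hb'⟩ := exists_isSimple_isContraction τ hτ
    exact ⟨σ, b' ∘ b, hσ, hb'.comp hb⟩
termination_by π.len

end FinPerm

namespace LabeledPerm

variable {L : Type u}

/-- The labeled pattern of `π` on the set `P` of indices. -/
noncomputable def pattern (π : LabeledPerm L) (P : Finset (Fin π.len)) : LabeledPerm L where
  toFinPerm := π.toFinPerm.pattern P
  label i := π.label (P.orderEmbOfFin rfl i)

theorem pattern_le [Preorder L] (π : LabeledPerm L) (P : Finset (Fin π.len)) : π.pattern P ≤ π :=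
  contained_iff_exists_sameOrder.2
    ⟨P.orderEmbOfFin rfl, π.toFinPerm.sameOrder_pattern P, fun _ => le_rfl⟩

theorem isInflation_of_isContraction {π : LabeledPerm L} {σ : FinPerm} {b : Fin π.len → Fin σ.len}
    (hb : π.IsContraction σ b) :
    π.IsInflation ⟨σ, fun k => π.pattern {i | b i = k}⟩
      fun k => Finset.orderEmbOfFin {i | b i = k} rfl := by
  have hmem (k a) : b (Finset.orderEmbOfFin {i | b i = k} rfl a) = k :=
    (Finset.mem_filter.1 (Finset.orderEmbOfFin_mem {i | b i = k} rfl a)).2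
  refine ⟨fun p => ⟨b p, ?_⟩, fun {i j} a a' hij => ?_, fun k a a' => ?_, fun _ _ => rfl⟩
  · change p ∈ range (Finset.orderEmbOfFin {i | b i = b p} rfl)
    simp
  · have h := hb.sameOrder _ _ ((hmem i a).trans_ne (hij.trans_eq (hmem j a').symm))
    rwa [hmem i a, hmem j a'] at h
  · exact (π.toFinPerm.sameOrder_pattern {i | b i = k} a a').symm

theorem exists_isSimple_isInflation [Preorder L] (π : LabeledPerm L) (hπ : 2 ≤ π.len) :
    ∃ σ : LabeledPerm (LabeledPerm L), σ.IsSimple ∧ σ.toFinPerm.Contained π.toFinPerm ∧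
      (∀ i, σ.label i ≤ π ∧ (σ.label i).len < π.len) ∧ ∃ entry, π.IsInflation σ entry := by
  obtain ⟨σ, b, hσ, hb⟩ := π.toFinPerm.exists_isSimple_isContraction hπ
  refine ⟨_, hσ, hb.contained, fun k => ⟨π.pattern_le _, ?_⟩, _, isInflation_of_isContraction hb⟩
  have : Nontrivial (Fin σ.len) := Fin.nontrivial_iff_two_le.2 hσ.1
  obtain ⟨l, hl⟩ := exists_ne k
  obtain ⟨p, rfl⟩ := hb.surjective l
  simpa [pattern, FinPerm.pattern] using
    Finset.card_lt_univ_of_notMem (s := {i | b i = k}) (x := p) (by simpa using hl)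

end LabeledPerm

namespace FinPerm

theorem IsClass.isLWQO_of_isSimple {C : Set FinPerm} (hC : IsClass C)
    (hS : IsLWQO.{u} {σ ∈ C | σ.IsSimple}) : IsLWQO.{u} C := by
  intro L _ hL
  rw [PartiallyWellOrderedOn.iff_not_exists_isMinBadSeq fun π => π.len]
  rintro ⟨f, hbad, hmin⟩
  let B := {β ∈ labeled C L | ∃ n, β.Contained (f n) ∧ β.len < (f n).len}
  have hB : B.PartiallyWellOrderedOn LabeledPerm.Contained :=
    partiallyWellOrderedOn_of_isMinBadSeq hbad hmin
  have hf (n) : f n ∈ labeled {π | π.len ≤ 1} L ∪ LabeledPerm.inflation {σ ∈ C | σ.IsSimple} B := by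
    obtain hlen | hlen := Nat.lt_or_ge 1 (f n).len
    · obtain ⟨σ, hσ, hσf, hblock, hentry⟩ := (f n).exists_isSimple_isInflation hlen
      have hblockC (i) : (σ.label i).toFinPerm ∈ C := by
        obtain ⟨g, hg, -⟩ := (hblock i).1
        exact hC _ (hbad.1 n) _ ⟨g, hg⟩
      exact Or.inr ⟨σ, ⟨hC _ (hbad.1 n) _ hσf, hσ⟩, fun i => ⟨hblockC i, n, hblock i⟩, hentry⟩
    · exact Or.inl hlen
  obtain ⟨m, n, hmn, h⟩ :=
    ((isLWQO_setOf_len_le_one L hL).union (hS.partiallyWellOrderedOn_inflation hB)).exists_lt hf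
  exact hbad.2 m n hmn h

theorem val_inflate_perm_apply (σ : FinPerm) (α : Fin σ.len → FinPerm) (i : Fin σ.len)
    (a : Fin (α i).len) :
    ((σ.inflate α).perm (finSigmaFinEquiv ⟨i, a⟩)).val =
      (finSigmaFinEquiv (n := fun k => (α (σ.perm.symm k)).len)
        ⟨σ.perm i, Fin.cast (by simp) ((α i).perm a)⟩).val := by
  have hleft : (Equiv.sigmaCongrLeft' (β := fun i => Fin (α i).len) σ.perm)
      ⟨i, (α i).perm a⟩ = ⟨σ.perm i, Fin.cast (by simp) ((α i).perm a)⟩ := by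
    rw [Equiv.sigmaCongrLeft', Equiv.symm_apply_eq]
    refine Sigma.ext (σ.perm.symm_apply_apply i).symm ?_
    exact (Fin.heq_ext_iff (by simp)).2 rfl
  rw [← hleft]
  change ((finSigmaFinEquiv (n := fun k => (α (σ.perm.symm k)).len)
    (Equiv.sigmaCongrLeft' (β := fun i => Fin (α i).len) σ.perm
      (Equiv.sigmaCongrRight (fun i => (α i).perm)
        (finSigmaFinEquiv.symm (finSigmaFinEquiv ⟨i, a⟩)))) : Fin _) : ℕ) = _
  rw [Equiv.symm_apply_apply]
  rfl

theorem inflate_perm_lt_iff_of_fst_ne (σ : FinPerm) (α : Fin σ.len → FinPerm) {i j : Fin σ.len}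
    (hij : i ≠ j) (a : Fin (α i).len) (b : Fin (α j).len) :
    (σ.inflate α).perm (finSigmaFinEquiv ⟨i, a⟩) < (σ.inflate α).perm (finSigmaFinEquiv ⟨j, b⟩) ↔
      σ.perm i < σ.perm j := by
  rw [Fin.lt_def, val_inflate_perm_apply, val_inflate_perm_apply, ← Fin.lt_def,
    finSigmaFinEquiv_lt_iff_of_fst_ne (σ.perm.injective.ne hij)]

theorem inflate_perm_lt_iff (σ : FinPerm) (α : Fin σ.len → FinPerm) (i : Fin σ.len)
    (a b : Fin (α i).len) :
    (σ.inflate α).perm (finSigmaFinEquiv ⟨i, a⟩) < (σ.inflate α).perm (finSigmaFinEquiv ⟨i, b⟩) ↔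
      (α i).perm a < (α i).perm b := by
  rw [Fin.lt_def, val_inflate_perm_apply, val_inflate_perm_apply, ← Fin.lt_def,
    finSigmaFinEquiv_mk_lt_mk, Fin.lt_def, Fin.val_cast, Fin.val_cast, ← Fin.lt_def]

theorem isInflation_inflate {L : Type u} (σ : FinPerm) (α : Fin σ.len → FinPerm)
    (β : ∀ i, Fin (α i).len → L) {label : Fin (σ.inflate α).len → L}
    (hlabel : ∀ i a, label (finSigmaFinEquiv ⟨i, a⟩) = β i a) :
    LabeledPerm.IsInflation ⟨σ.inflate α, label⟩ ⟨σ, fun i => ⟨α i, β i⟩⟩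
      fun i a => finSigmaFinEquiv (n := fun i => (α i).len) ⟨i, a⟩ where
  exists_eq p := ⟨_, _, finSigmaFinEquiv.apply_symm_apply (p : Fin (∑ i, (α i).len))⟩
  sameOrder_of_ne a b hij :=
    ⟨finSigmaFinEquiv_lt_iff_of_fst_ne (n := fun i => (α i).len) hij a b,
      inflate_perm_lt_iff_of_fst_ne σ α hij a b⟩
  sameOrder i a b :=
    ⟨finSigmaFinEquiv_mk_lt_mk (n := fun i => (α i).len), inflate_perm_lt_iff σ α i a b⟩
  label_eq := hlabel

theorem isWQO_iff_labeled_punit {C : Set FinPerm} :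
    IsWQO C ↔ (labeled C PUnit.{u + 1}).PartiallyWellOrderedOn LabeledPerm.Contained := by
  rw [IsWQO, partiallyWellOrderedOn_iff_exists_lt, partiallyWellOrderedOn_iff_exists_lt]
  constructor
  · intro h π hπ
    obtain ⟨m, n, hmn, f, hf⟩ := h (fun n => (π n).toFinPerm) hπ
    exact ⟨m, n, hmn, f, hf, fun _ => le_rfl⟩
  · intro h π hπ
    obtain ⟨m, n, hmn, f, hf, -⟩ := h (fun n => ⟨π n, fun _ => PUnit.unit⟩) hπ
    exact ⟨m, n, hmn, f, hf⟩

theorem IsLWQO.isWQO_inflation {C U : Set FinPerm} (hC : IsLWQO.{u} C) (hU : IsWQO U) :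
    IsWQO (inflation C U) := by
  rw [isWQO_iff_labeled_punit.{u}] at hU ⊢
  refine (hC.partiallyWellOrderedOn_inflation hU).mono ?_
  rintro ⟨-, label⟩ ⟨σ, hσ, α, hα, rfl⟩
  exact ⟨⟨σ, fun i => ⟨α i, fun _ => PUnit.unit⟩⟩, hσ, fun i => (hα i).1, _,
    isInflation_inflate σ α _ fun _ _ => rfl⟩

end FinPerm

theorem mainTheorem11_general {C : Set FinPerm} (hC : FinPerm.IsClass C)
    (hS : FinPerm.IsLWQO.{u} {σ ∈ C | σ.IsSimple}) :
    FinPerm.IsLWQO.{u} C ∧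
      ∀ U : Set FinPerm, FinPerm.IsWQO U → FinPerm.IsWQO (FinPerm.inflation C U) :=
  have hlwqo := hC.isLWQO_of_isSimple hS
  ⟨hlwqo, fun _ => hlwqo.isWQO_inflation⟩

theorem mainTheorem11 (C : Set FinPerm) (hC : FinPerm.IsClass C)
    (hS : FinPerm.GeometricallyGriddable {σ ∈ C | σ.IsSimple}) :
    FinPerm.IsLWQO.{u} C ∧
      ∀ U : Set FinPerm, FinPerm.IsClass U → FinPerm.IsWQO U →
        FinPerm.IsWQO (FinPerm.inflation C U) :=
  (mainTheorem11_general hC hS.isLWQO).imp_right fun hwqo U _ => hwqo U
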